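/- Let $f_c(z)=z^2+c$ and write $f_c^{\circ n}$ for its $n$-th iterate. For $n\ge 1$ let $$\Phi_n^*(z,c)=\prod_{d\mid n}\bigl(f_c^{\circ d}(z)-z\bigr)^{\mu(n/d)}\in\mathbb{Z}[c][z]$$ be the $n$-th dynatomic polynomial, and let the $n$-th multiplier polynomial $\delta_n(x,c)\in\mathbb{Z}[c][x]$ be the polynomial, monic in $x$, with $$\delta_n(x,c)^n=\operatorname{Res}_z\bigl(\Phi_n^*(z,c),\,x-(f_c^{\circ n})'(z)\bigr).$$ For positive integers $m\mid n$ with $m<n$ let $$\Delta_{n,m}(c)=\operatorname{Res}_x\bigl(\mathrm{Cyc}_{n/m}(x),\,\delta_m(x,c)\bigr),\qquad \widetilde{\Delta}_{n,m}(C)=\Delta_{n,m}(C/4),$$ where $\mathrm{Cyc}_j$ is the $j$-th cyclotomic polynomial. Let $\mathbb{Q}^{\mathrm{ab}}\subset\mathbb{C}$ be the maximal abelian extension of $\mathbb{Q}$. **Theorem.** For every integer $k\ge 2$, the polynomial $\widetilde{\Delta}_{3k,3}$ has no roots in $\mathbb{Q}^{\mathrm{ab}}$. -/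

import Mathlib

open Polynomial

noncomputable section

/-- The `n`-th iterate `f_c^{∘n}(z)` of `f_c(z) = z ^ 2 + c`, as a polynomial in `z`
(outer variable) with coefficients in `ℤ[c]` (inner variable). -/
def quadIter (n : ℕ) : ℤ[X][X] :=
  (fun p : ℤ[X][X] => (X ^ 2 + C X : ℤ[X][X]).comp p)^[n] X

/-- The `n`-th dynatomic polynomial
`Φ*_n(z, c) = ∏_{k ∣ n} (f_c^{∘k}(z) - z) ^ μ(n / k) ∈ ℤ[c][z]`.
The factors with `μ(n / k) = 1` are multiplied together and divided by the product of the factors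
with `μ(n / k) = -1`. All factors are monic in `z` and the division is exact. -/
def dynatomicPoly (n : ℕ) : ℤ[X][X] :=
  (∏ k ∈ n.divisors with ArithmeticFunction.moebius (n / k) = 1, (quadIter k - X)) /ₘ
    (∏ k ∈ n.divisors with ArithmeticFunction.moebius (n / k) = -1, (quadIter k - X))

/-- `Res_z(Φ*_n(z, c), x - (f_c^{∘n})'(z))`, as a polynomial in `x` with coefficients in `ℤ[c]`.
The resultant is taken in `(ℤ[c][x])[z]`. -/
def multiplierResultant (n : ℕ) : ℤ[X][X] :=
  resultant ((dynatomicPoly n).map (C : ℤ[X] →+* ℤ[X][X]))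
    (C X - (derivative (quadIter n)).map (C : ℤ[X] →+* ℤ[X][X]))

/-- `d ∈ ℤ[c][x]` is the `n`-th multiplier polynomial: it is monic in `x` and
`d ^ n = Res_z(Φ*_n(z, c), x - (f_c^{∘n})'(z))`. For `n ≥ 1` there is at most one such `d`. -/
def IsMultiplierPoly (n : ℕ) (d : ℤ[X][X]) : Prop :=
  d.Monic ∧ d ^ n = multiplierResultant n

open Classical in
/-- The `n`-th multiplier polynomial `δ_n(x, c)`, as a polynomial in `x` with coefficients in
`ℤ[c]` (it would be `0` if no monic `n`-th root of the resultant existed). -/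
def multiplierPoly (n : ℕ) : ℤ[X][X] :=
  if h : ∃ d, IsMultiplierPoly n d then h.choose else 0

/-- The delta factor `Δ_{n,m}(c) = Res_x(Φ_{n/m}(x), δ_m(x, c)) ∈ ℤ[c]`, for positive integers
`m ∣ n` with `m < n`, where `Φ_j` denotes the `j`-th cyclotomic polynomial. -/
def deltaFactor (n m : ℕ) : ℤ[X] :=
  resultant (cyclotomic (n / m) ℤ[X]) (multiplierPoly m)

/-- The rescaled delta factor `Δ̃_{n,m}(C) = Δ_{n,m}(C / 4)`. -/
def deltaFactorTilde (n m : ℕ) : ℚ[X] :=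
  ((deltaFactor n m).map (Int.castRingHom ℚ)).comp (C (1 / 4) * X)

/-- The maximal abelian extension `ℚ^ab` of `ℚ`, realised inside `ℂ`: the compositum of all
subfields of `ℂ` that are abelian Galois extensions of `ℚ`. -/
def ratAb : IntermediateField ℚ ℂ :=
  ⨆ K : {K : IntermediateField ℚ ℂ // IsAbelianGalois ℚ K}, K.1

end

/-! At a root `x`, some primitive `k`-th root of unity `ζ` is the multiplier of a 3-cycle, which
amounts to `(ζ - 8 - x)² = -x²(x + 7)`. With `s = (ζ - 8 - x)/x` this becomes `s(s² + s + 7) = 1 -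
ζ`, so it suffices to exclude such an `s` in an abelian number field
(`cubic_ne_one_sub_root_of_unity`).

The root `s` of the cubic can be chosen so that conjugation preserves the ideal `(s)`. If `k` is not
a prime power, `s` is a unit; otherwise this follows from total ramification of `p` in `ℚ(ζ)`
(`conj_dvd_self_of_dvd_sub_one`). Then `e = conj s / s` is a unit of absolute value 1 everywhere,
and conjugating the equation gives `q = θ * conj q` for `q = s² + s + 7`, `θ = -eζ`; hence `s ∣ 7(1
- θ)`. If `θ ≠ 1`, then `(1 - θ)³q²/s²` is a nonzero algebraic integer with all absolute values
below 1, which is impossible. If `θ = 1`, either `s` is totally real or `(1 - ζ)s = ζ`, and again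
some nonzero integer is too small (`cubic_ne_of_conj_dvd`). -/

open NumberField ComplexConjugate
open scoped Pointwise

/-! ### Complex conjugation and prime ideals in abelian number fields -/

section AbelianFields

open scoped IsMulCommutative

variable {K : Type*} [Field K] [NumberField K]

/-- An abelian number field has an automorphism inducing complex conjugation in every complex
embedding. -/
theorem exists_gal_eq_conj [IsAbelianGalois ℚ K] :
    ∃ c : Gal(K/ℚ), ∀ (φ : K →+* ℂ) (x : K), φ (c x) = conj (φ x) := by
  let φ : K →+* ℂ := Classical.choice (inferInstance : Nonempty _)
  obtain ⟨σ, hσ⟩ := ComplexEmbedding.exists_comp_symm_eq_of_comp_eq (k := ℚ) φ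
    (ComplexEmbedding.conjugate φ) (by ext; simp)
  have key : ∀ x, φ (σ.symm x) = conj (φ x) := fun x ↦ by
    simpa using congrArg (fun f : K →+* ℂ ↦ f x) hσ
  refine ⟨σ.symm, fun ψ x ↦ ?_⟩
  -- Any other embedding differs from `φ` by an automorphism, which commutes with `σ`.
  obtain ⟨ν, rfl⟩ := ComplexEmbedding.exists_comp_symm_eq_of_comp_eq (k := ℚ) φ ψ (by ext; simp)
  have hcomm : ν.symm (σ.symm x) = σ.symm (ν.symm x) := by
    have := mul_comm (ν⁻¹ : Gal(K/ℚ)) σ⁻¹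
    exact congrArg (fun f : Gal(K/ℚ) ↦ f x) this
  simp only [RingHom.comp_apply, RingHom.coe_coe]
  rw [hcomm, key]

/-- A nonzero algebraic integer has a conjugate of absolute value at least `1`. -/
theorem exists_one_le_norm_embedding {x : K} (hx : IsIntegral ℤ x) (h0 : x ≠ 0) :
    ∃ φ : K →+* ℂ, 1 ≤ ‖φ x‖ := by
  by_contra! h
  -- Kronecker's theorem makes `x` a root of unity.
  obtain ⟨n, hn, hxn⟩ := Embeddings.pow_eq_one_of_norm_le_one K ℂ h0 hx fun φ ↦ (h φ).le
  let φ : K →+* ℂ := Classical.choice (inferInstance : Nonempty _)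
  have h1 : ‖φ x‖ ^ n = 1 := by rw [← norm_pow, ← map_pow, hxn, map_one, norm_one]
  exact (pow_lt_one₀ (norm_nonneg _) (h φ) hn.ne').ne h1

variable {p a : ℕ}

/-- The cyclotomic polynomial of order `p ^ (a + 1)` takes the value `p` at 1 and vanishes at `ζ`.
-/
theorem sub_one_dvd_natCast_prime {R : Type*} [CommRing R] [IsDomain R] [CharZero R]
    (hp : p.Prime) {ζ : R} (hζ : IsPrimitiveRoot ζ (p ^ (a + 1))) :
    ζ - 1 ∣ (p : R) := by
  have : Fact p.Prime := ⟨hp⟩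
  have h := sub_dvd_eval_sub ζ 1 (cyclotomic (p ^ (a + 1)) R)
  rw [eval_one_cyclotomic_prime_pow] at h
  have h0 : IsRoot (cyclotomic (p ^ (a + 1)) R) ζ :=
    hζ.isRoot_cyclotomic (pow_pos hp.pos _)
  rw [h0.eq_zero, zero_sub, dvd_neg] at h
  exact h

/-- Over the prime of `ℚ(ζ)` above `p`, where `ζ` has `p`-power order, automorphisms of an
extension permute the primes like automorphisms that fix `ζ`. -/
theorem exists_gal_fixing_smul_eq [IsGalois ℚ K] (hp : p.Prime) {ζ : 𝓞 K}
    (hζ : IsPrimitiveRoot (ζ : K) (p ^ (a + 1))) (P : Ideal (𝓞 K)) [hP : P.IsPrime]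
    (hmem : ζ - 1 ∈ P) (c : Gal(K/ℚ)) :
    ∃ g : Gal(K/ℚ), g ζ = ζ ∧ c • P = g • P := by
  have : Fact p.Prime := ⟨hp⟩
  have : NeZero (p ^ (a + 1)) := ⟨(pow_pos hp.pos _).ne'⟩
  have hζ' : IsPrimitiveRoot ζ (p ^ (a + 1)) :=
    hζ.of_map_of_injective (f := algebraMap (𝓞 K) K) RingOfIntegers.coe_injective
  let F := IntermediateField.adjoin ℚ {(ζ : K)}
  have hcyc : IsCyclotomicExtension {p ^ (a + 1)} ℚ F :=
    hζ.intermediateField_adjoin_isCyclotomicExtension ℚ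
  let z : F := ⟨ζ, IntermediateField.mem_adjoin_simple_self ℚ _⟩
  have hz : IsPrimitiveRoot z (p ^ (a + 1)) :=
    hζ.of_map_of_injective (f := algebraMap F K) (algebraMap F K).injective
  have hint := IsCyclotomicExtension.Rat.isIntegralClosure_adjoin_singleton hz
  have hp_mem : ∀ Q : Ideal (𝓞 K), ζ - 1 ∈ Q → (p : 𝓞 K) ∈ Q := fun Q hQ ↦
    Ideal.mem_of_dvd _ (sub_one_dvd_natCast_prime hp hζ') hQ
  -- Membership of `f(ζ)` in a prime containing `ζ - 1` depends on `f(1)` modulo `p` only.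
  have hcrit : ∀ (Q : Ideal (𝓞 K)), Q.IsPrime → ζ - 1 ∈ Q → ∀ f : ℤ[X],
      aeval ζ f ∈ Q ↔ (p : ℤ) ∣ f.eval 1 := by
    intro Q hQ hQmem f
    have hdvd : ζ - 1 ∣ aeval ζ f - ((f.eval 1 : ℤ) : 𝓞 K) := by
      have := sub_dvd_eval_sub ζ 1 (f.map (Int.castRingHom (𝓞 K)))
      rw [eval_map, eval_one_map] at this
      simpa [aeval_def] using this
    have hsub := Ideal.mem_of_dvd _ hdvd hQmem
    rw [← Ideal.add_mem_iff_right Q (a := -(aeval ζ f - ((f.eval 1 : ℤ) : 𝓞 K)))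
      (Q.neg_mem hsub)]
    rw [show -(aeval ζ f - ((f.eval 1 : ℤ) : 𝓞 K)) + aeval ζ f = ((f.eval 1 : ℤ) : 𝓞 K) by ring]
    have hpQ : ((p : ℤ) : 𝓞 K) ∈ Q := by simpa using hp_mem Q hQmem
    constructor
    · intro h
      by_contra hnd
      have hcop : IsCoprime (p : ℤ) (f.eval 1) :=
        (Nat.prime_iff_prime_int.mp hp).coprime_iff_not_dvd.mpr hnd
      obtain ⟨u, v, huv⟩ := hcop
      apply hQ.ne_top
      rw [Ideal.eq_top_iff_one]
      have h1 : ((u : ℤ) : 𝓞 K) * ((p : ℤ) : 𝓞 K) + (v : 𝓞 K) * ((f.eval 1 : ℤ) : 𝓞 K) = 1 := by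
        exact_mod_cast congrArg (Int.cast : ℤ → 𝓞 K) huv
      rw [← h1]
      exact Q.add_mem (Q.mul_mem_left _ hpQ) (Q.mul_mem_left _ h)
    · rintro ⟨m, hm⟩
      rw [hm, Int.cast_mul]
      exact Q.mul_mem_right _ hpQ
  have hcP : ζ - 1 ∈ c • P := by
    -- `c` sends `ζ` to a power of itself
    have hc : IsPrimitiveRoot (c⁻¹ • ζ) (p ^ (a + 1)) :=
      hζ'.map_of_injective (f := MulSemiringAction.toRingHom _ (𝓞 K) c⁻¹)
        (MulAction.injective c⁻¹)
    obtain ⟨i, -, hi⟩ := hζ'.eq_pow_of_pow_eq_one hc.pow_eq_one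
    rw [← Ideal.smul_mem_pointwise_smul_iff (a := c⁻¹), inv_smul_smul, smul_sub, smul_one, ← hi]
    exact Ideal.mem_of_dvd _ (by simpa using sub_dvd_pow_sub_pow ζ 1 i) hmem
  -- Since `𝓞 F = ℤ[ζ]`, `hcrit` shows that both primes lie over the same prime of `F`, so
  -- `Gal(K/F)` carries one to the other.
  have hunder : Ideal.under (𝓞 F) P = Ideal.under (𝓞 F) (c • P) := by
    ext b
    have hb : IsIntegral ℤ (b : F) := b.isIntegral_coe
    obtain ⟨y, hy⟩ := hint.isIntegral_iff.mp hb
    obtain ⟨f, hf⟩ : (y : F) ∈ (aeval (R := ℤ) z).range :=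
      (Algebra.adjoin_singleton_eq_range_aeval ℤ z).le y.2
    have hbf : algebraMap (𝓞 F) (𝓞 K) b = aeval ζ f := by
      apply RingOfIntegers.coe_injective
      have h1 : (b : F) = aeval z f := by
        rw [← hy]; exact hf.symm
      have h2 : ((algebraMap (𝓞 F) (𝓞 K) b : 𝓞 K) : K) = algebraMap F K (b : F) := rfl
      refine h2.trans ?_
      rw [h1, ← aeval_algebraMap_apply]
      exact aeval_algebraMap_apply K ζ f
    simp only [Ideal.under, Ideal.mem_comap, hbf]
    rw [hcrit P hP hmem, hcrit (c • P) inferInstance hcP]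
  obtain ⟨g, hg⟩ := Algebra.IsInvariant.exists_smul_of_under_eq (𝓞 F) (𝓞 K) Gal(K/F) P (c • P)
    hunder
  refine ⟨g.restrictScalars ℚ, ?_, hg⟩
  exact g.commutes z

theorem dvd_of_forall_mem_prime_pow {R : Type*} [CommRing R] [IsDedekindDomain R] {x y : R}
    (hx : x ≠ 0)
    (h : ∀ (P : Ideal R) (n : ℕ), P.IsPrime → n ≠ 0 → x ∈ P ^ n → y ∈ P ^ n) : x ∣ y := by
  rw [← Ideal.span_singleton_le_span_singleton, ← Ideal.dvd_iff_le,
    UniqueFactorizationMonoid.dvd_iff_emultiplicity_le (by simpa using hx)]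
  intro P hP
  rw [emultiplicity_le_emultiplicity_iff]
  intro n hn
  rw [Ideal.dvd_span_singleton] at hn ⊢
  rcases eq_or_ne n 0 with rfl | h0
  · simp
  · exact h P n (Ideal.isPrime_of_prime hP) h0 hn

/-- If a divisor `s` of `ζ - 1` is fixed by cubes of the automorphisms that fix `ζ`, then the
ideal `(s)` is stable under all involutions in an abelian extension. -/
theorem conj_dvd_self_of_dvd_sub_one [IsAbelianGalois ℚ K] (hp : p.Prime) {ζ s : 𝓞 K}
    (hζ : IsPrimitiveRoot (ζ : K) (p ^ (a + 1))) (hs0 : s ≠ 0) (hs : s ∣ ζ - 1)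
    (hfix : ∀ g : Gal(K/ℚ), g ζ = ζ → g • g • g • s = s) (c : Gal(K/ℚ)) (hc : c * c = 1) :
    c • s ∣ s := by
  have hζ' : IsPrimitiveRoot ζ (p ^ (a + 1)) :=
    hζ.of_map_of_injective (f := algebraMap (𝓞 K) K) RingOfIntegers.coe_injective
  refine dvd_of_forall_mem_prime_pow ((smul_ne_zero_iff_ne c).mpr hs0) fun P n hP hn hmem ↦ ?_
  have hcζ : ζ - 1 ∈ P := by
    have h1 : c • (ζ - 1) ∈ P :=
      Ideal.mem_of_dvd _ (map_dvd (MulSemiringAction.toRingHom _ (𝓞 K) c) hs)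
        (Ideal.pow_le_self hn hmem)
    have hcr : IsPrimitiveRoot (c • ζ) (p ^ (a + 1)) :=
      hζ'.map_of_injective (f := MulSemiringAction.toRingHom _ (𝓞 K) c) (MulAction.injective c)
    have : NeZero (p ^ (a + 1)) := ⟨(pow_pos hp.pos _).ne'⟩
    obtain ⟨i, -, hi⟩ := hcr.eq_pow_of_pow_eq_one hζ'.pow_eq_one
    rw [smul_sub, smul_one] at h1
    refine Ideal.mem_of_dvd _ ?_ h1
    conv_rhs => rw [← hi]
    simpa using sub_dvd_pow_sub_pow (c • ζ) 1 i
  obtain ⟨g, hg, hgP⟩ := exists_gal_fixing_smul_eq hp hζ P hcζ c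
  -- Commutativity gives `g² • P = c² • P = P`. Applying `g³`, which fixes `s`, to `s ∈ g • Pⁿ` then
  -- yields `s ∈ g⁴ • Pⁿ = Pⁿ`.
  have hggP : g • g • P = P := by
    rw [← hgP, smul_smul, mul_comm, ← smul_smul, ← hgP, smul_smul, hc, one_smul]
  have h1 : s ∈ g • P ^ n := by
    rw [smul_pow', ← hgP, ← smul_pow', ← Ideal.smul_mem_pointwise_smul_iff (a := c), smul_smul, hc,
      one_smul]
    exact hmem
  have hggPn : g • g • P ^ n = P ^ n := by rw [smul_pow', smul_pow', hggP]
  have h2 : g • g • g • s ∈ g • g • g • g • P ^ n := by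
    iterate 3 rw [Ideal.smul_mem_pointwise_smul_iff]
    exact h1
  rw [hfix g hg, hggPn, hggPn] at h2
  exact h2

end AbelianFields

/-! ### Archimedean estimates for the cubic -/

section CubicBounds

/-- The roots of `s(s² + s + 7) = 0` have absolute values 0 and `√7`; a right-hand side of size at
most 2 does not let the two ranges meet. -/
theorem norm_small_or_large_of_cubic {s : ℂ} (h : ‖s * (s ^ 2 + s + 7)‖ ≤ 2) :
    ‖s‖ ≤ 31 / 100 ∨ 23 / 4 ≤ ‖s‖ ^ 2 := by
  rw [norm_mul] at h
  set r := ‖s‖ with hr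
  have hr0 : 0 ≤ r := norm_nonneg s
  rcases lt_or_ge r 2 with h2 | h2
  · left
    have h7 : 7 - r - r ^ 2 ≤ ‖s ^ 2 + s + 7‖ := by
      have h1 : ‖(7 : ℂ)‖ ≤ ‖s ^ 2 + s + 7‖ + ‖s ^ 2 + s‖ := by
        have := norm_sub_le (s ^ 2 + s + 7) (s ^ 2 + s)
        rwa [add_sub_cancel_left] at this
      have h3 : ‖s ^ 2 + s‖ ≤ r ^ 2 + r :=
        (norm_add_le (s ^ 2) s).trans_eq (by rw [norm_pow])
      have h4 : ‖(7 : ℂ)‖ = 7 := by norm_num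
      linarith
    have h5 : r * (7 - r - r ^ 2) ≤ 2 := (mul_le_mul_of_nonneg_left h7 hr0).trans h
    -- `r³ + r² - 7r + 2 = (r - 2)(r² + 3r - 1)`.
    have h6 : r ^ 2 + 3 * r - 1 ≤ 0 := by
      by_contra! h8
      nlinarith [mul_pos (sub_pos.mpr h2) h8]
    nlinarith
  · right
    have hq : ‖s ^ 2 + s + 7‖ ≤ 1 := by nlinarith [norm_nonneg (s ^ 2 + s + 7)]
    have hre := (Complex.re_le_norm (s ^ 2 + s + 7)).trans hq
    have hre' : (s ^ 2 + s + 7).re = s.re ^ 2 - s.im ^ 2 + s.re + 7 := by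
      simp [pow_two]
    have hn : r ^ 2 = s.re ^ 2 + s.im ^ 2 := by
      rw [hr, Complex.sq_norm, Complex.normSq_apply]; ring
    rw [hre'] at hre
    rw [hn]
    nlinarith [sq_nonneg (s.re + 1 / 2), sq_nonneg s.re]

/-- For small `s`, `h` bounds `1 - t` by a multiple of `s`, and the cube beats `s²` by a factor
`‖s‖`. For large `s`, the trivial bounds suffice, as `2³ * 2² < (23/4)²`. -/
theorem norm_cube_mul_sq_lt {s y t e : ℂ} (hy : s * (s ^ 2 + s + 7) = y) (hy2 : ‖y‖ ≤ 2)
    (hs : s ≠ 0) (ht : ‖t‖ = 1) (he : ‖e‖ = 1)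
    (h : 7 * (1 - t) = -(s * ((1 - t * e ^ 2) * s + (1 - t * e)))) :
    ‖(1 - t) ^ 3 * (s ^ 2 + s + 7) ^ 2‖ < ‖s ^ 2‖ := by
  have hcases := norm_small_or_large_of_cubic (hy ▸ hy2)
  have hsub : ∀ z : ℂ, ‖z‖ = 1 → ‖1 - z‖ ≤ 2 := fun z hz ↦ by
    have := norm_sub_le 1 z
    rw [norm_one, hz] at this
    linarith
  have hw2 : ‖1 - t‖ ≤ 2 := hsub t ht
  have h7w : 7 * ‖1 - t‖ ≤ 2 * ‖s‖ * (1 + ‖s‖) := by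
    have h1 := congrArg norm h
    rw [norm_mul, norm_neg, norm_mul] at h1
    have h2 : ‖(7 : ℂ)‖ = 7 := by norm_num
    have h3 : ‖(1 - t * e ^ 2) * s + (1 - t * e)‖ ≤ 2 * ‖s‖ + 2 := by
      refine (norm_add_le _ _).trans (add_le_add ?_ (hsub _ (by simp [ht, he])))
      rw [norm_mul]
      exact mul_le_mul_of_nonneg_right (hsub _ (by simp [ht, he])) (norm_nonneg _)
    rw [h2] at h1
    rw [h1]
    nlinarith [norm_nonneg s]
  have hrm : ‖s‖ * ‖s ^ 2 + s + 7‖ ≤ 2 := by rw [← norm_mul, hy]; exact hy2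
  have hm : ‖s ^ 2 + s + 7‖ ≤ ‖s‖ ^ 2 + ‖s‖ + 7 := by
    refine (norm_add₃_le).trans ?_
    simp
  rw [norm_mul, norm_pow, norm_pow, norm_pow]
  have hr : 0 < ‖s‖ := norm_pos_iff.mpr hs
  have hw := norm_nonneg (1 - t)
  have hm0 := norm_nonneg (s ^ 2 + s + 7)
  generalize ‖1 - t‖ = w at *
  generalize ‖s ^ 2 + s + 7‖ = m at *
  generalize ‖s‖ = r at *
  rcases hcases with hc | hc
  · have h1 : w ≤ 2 / 7 * (1.31 * r) := by nlinarith
    -- `7.4061 = 0.31² + 0.31 + 7`.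
    have h2 : m ≤ 7.4061 := by nlinarith
    have h3 : w ^ 3 ≤ (2 / 7 * (1.31 * r)) ^ 3 := pow_le_pow_left₀ hw h1 3
    have h4 : m ^ 2 ≤ 7.4061 ^ 2 := pow_le_pow_left₀ hm0 h2 2
    have h5 : w ^ 3 * m ^ 2 ≤ (2 / 7 * (1.31 * r)) ^ 3 * 7.4061 ^ 2 :=
      mul_le_mul h3 h4 (by positivity) (by positivity)
    have h6 : (2 / 7 * (1.31 * r)) ^ 3 * 7.4061 ^ 2 < r ^ 2 := by
      have h8 : (2 / 7 * (1.31 * r)) ^ 3 * 7.4061 ^ 2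
        = (2 / 7 * 1.31) ^ 3 * 7.4061 ^ 2 * r * r ^ 2 := by ring
      have h9 : (2 / 7 * 1.31) ^ 3 * 7.4061 ^ 2 * r < 1 := by norm_num; linarith
      rw [h8]
      nlinarith [pow_pos hr 2]
    linarith
  · have h3 : w ^ 3 ≤ 2 ^ 3 := pow_le_pow_left₀ hw hw2 3
    have h4 : (r * m) ^ 2 ≤ 2 ^ 2 := pow_le_pow_left₀ (by positivity) hrm 2
    have h5 : w ^ 3 * (r * m) ^ 2 ≤ 2 ^ 3 * 2 ^ 2 := mul_le_mul h3 h4 (by positivity) (by positivity)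
    by_contra! hlt
    nlinarith [mul_le_mul_of_nonneg_left hlt (sq_nonneg r)]

end CubicBounds

/-! ### Choosing a root of the cubic under an abelian action -/

section CubicRoots

open scoped IsMulCommutative

/-- Over an abelian group action, a root of `X³ + X² + 7X - y` can be chosen so that the cube of
every element fixing `y` fixes it. -/
theorem exists_root_fixed_by_cubes {R G : Type*} [CommRing R] [IsDomain R] [Group G]
    [IsMulCommutative G] [MulSemiringAction G R] {y s : R} (hs : s ^ 3 + s ^ 2 + 7 * s = y) :
    ∃ r : R, r ^ 3 + r ^ 2 + 7 * r = y ∧ ∀ g : G, g • y = y → g • g • g • r = r := by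
  have h7 : ∀ g : G, g • (7 : R) = 7 := fun g ↦ by
    simpa using map_ofNat (MulSemiringAction.toRingHom G R g) 7
  have hroot : ∀ (g : G) (x : R), g • y = y → x ^ 3 + x ^ 2 + 7 * x = y →
      (g • x) ^ 3 + (g • x) ^ 2 + 7 * (g • x) = y := fun g x hg hx ↦ by
    have := congrArg (g • ·) hx
    simpa [smul_pow', h7, hg] using this
  -- Two distinct roots determine the third.
  have hthird : ∀ a b : R, a ≠ b → a ^ 3 + a ^ 2 + 7 * a = y → b ^ 3 + b ^ 2 + 7 * b = y →
      ∀ x, x ^ 3 + x ^ 2 + 7 * x = y ↔ x = a ∨ x = b ∨ x = -1 - a - b := by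
    intro a b hab ha hb x
    have h1 : a ^ 2 + a * b + b ^ 2 + a + b + 7 = 0 := by
      apply mul_left_cancel₀ (sub_ne_zero.mpr hab)
      linear_combination ha - hb
    have h2 : x ^ 3 + x ^ 2 + 7 * x - y = (x - a) * (x - b) * (x - (-1 - a - b)) := by
      linear_combination ha + (x - a) * h1
    rw [← sub_eq_zero, h2, mul_eq_zero, mul_eq_zero, sub_eq_zero, sub_eq_zero, sub_eq_zero,
      or_assoc]
  by_cases hcase : ∃ g : G, g • y = y ∧ g • s ≠ s ∧ g • g • s = s
  -- If `g` swaps two roots, it fixes the third. Any image of the third root is again fixed by `g`,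
  -- by commutativity, so it is neither of the swapped ones.
  · obtain ⟨g, hgy, hgs, hggs⟩ := hcase
    have hT := hthird s (g • s) (Ne.symm hgs) hs (hroot g s hgy hs)
    have hr : (-1 - s - g • s) ^ 3 + (-1 - s - g • s) ^ 2 + 7 * (-1 - s - g • s) = y :=
      (hT _).mpr (Or.inr (Or.inr rfl))
    have hgr : g • (-1 - s - g • s) = -1 - s - g • s := by
      rw [smul_sub, smul_sub, smul_neg, smul_one, hggs]; ring
    have hfix : ∀ h : G, h • y = y → h • (-1 - s - g • s) = -1 - s - g • s := by
      intro h hy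
      have hcomm : g • h • (-1 - s - g • s) = h • (-1 - s - g • s) := by
        rw [smul_smul, mul_comm, ← smul_smul, hgr]
      rcases (hT _).mp (hroot h _ hy hr) with h1 | h1 | h1
      · rw [h1] at hcomm; exact absurd hcomm hgs
      · rw [h1, hggs] at hcomm; exact absurd hcomm.symm hgs
      · exact h1
    exact ⟨_, hr, fun h hy ↦ by rw [hfix h hy, hfix h hy, hfix h hy]⟩
  -- Otherwise each `g` fixing `y` either fixes `s` or permutes three roots cyclically.
  · push Not at hcase
    refine ⟨s, hs, fun g hg ↦ ?_⟩
    by_cases h1 : g • s = s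
    · rw [h1, h1, h1]
    have h2 := hcase g hg h1
    have hr1 := hroot g s hg hs
    have hr2 := hroot g _ hg hr1
    have hT := hthird s (g • s) (Ne.symm h1) hs hr1
    have hinj := MulAction.injective (β := R) g
    rcases (hT _).mp (hroot g _ hg hr2) with h3 | h3 | h3
    · exact h3
    · exact absurd (hinj h3) h2
    · rcases (hT _).mp hr2 with h4 | h4 | h4
      · exact absurd h4 h2
      · exact absurd (hinj h4) h1
      · rw [← h4] at h3; exact absurd (hinj (hinj h3)) h1

end CubicRoots

/-! ### The cubic equation in an abelian number field -/

section CubicEquation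

open scoped IsMulCommutative

variable {K : Type*} [Field K] [NumberField K]

theorem not_forall_norm_embedding_lt_one {x : 𝓞 K} (h0 : x ≠ 0) :
    ¬ ∀ φ : K →+* ℂ, ‖φ x‖ < 1 := fun h ↦ by
  obtain ⟨φ, hφ⟩ := exists_one_le_norm_embedding x.isIntegral_coe
    (RingOfIntegers.coe_ne_zero_iff.mpr h0)
  exact (h φ).not_ge hφ

theorem cubic_ne_of_conj_dvd {k : ℕ} (hk : 2 ≤ k) {ζ s : 𝓞 K}
    (hζ : IsPrimitiveRoot ζ k) (c : Gal(K/ℚ))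
    (hc : ∀ (φ : K →+* ℂ) (x : K), φ (c x) = conj (φ x)) (hdvd : c • s ∣ s)
    (hcop : (∃ N : ℤ, IsCoprime N 7 ∧ s ∣ (N : 𝓞 K)) ∨ 1 - ζ ∣ 7) :
    s * (s ^ 2 + s + 7) ≠ 1 - ζ := by
  intro hs
  let φ₀ : K →+* ℂ := Classical.choice (inferInstance : Nonempty _)
  have hconj : ∀ (φ : K →+* ℂ) (x : 𝓞 K), φ ((c • x : 𝓞 K) : K) = conj (φ (x : K)) :=
    fun φ x ↦ hc φ x
  have hnorm : ∀ x : 𝓞 K, x * c • x = 1 → ∀ φ : K →+* ℂ, ‖φ x‖ = 1 := by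
    intro x hx φ
    have h1 : φ (x : K) * conj (φ (x : K)) = 1 := by
      rw [← hconj, ← map_mul, ← map_mul, hx, map_one, map_one]
    rw [Complex.mul_conj'] at h1
    have h2 : ‖φ x‖ ^ 2 = 1 := by exact_mod_cast h1
    nlinarith [norm_nonneg (φ (x : K))]
  have hcc : ∀ x : 𝓞 K, c • c • x = x := fun x ↦ by
    apply RingOfIntegers.coe_injective
    apply φ₀.injective
    rw [hconj, hconj, Complex.conj_conj]
  have hζ1 : 1 - ζ ≠ 0 := sub_ne_zero.mpr (hζ.ne_one (by lia)).symm
  have hs0 : s ≠ 0 := by rintro rfl; simp at hs; exact hζ1 hs.symm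
  have hζc : ζ * c • ζ = 1 := by
    apply RingOfIntegers.coe_injective
    apply φ₀.injective
    have h1 : ‖φ₀ ζ‖ = 1 := by
      have h2 := hζ.map_of_injective (f := φ₀.comp (algebraMap (𝓞 K) K))
        (φ₀.injective.comp RingOfIntegers.coe_injective)
      exact h2.norm'_eq_one (by lia)
    rw [map_mul, map_mul, hconj, Complex.mul_conj', h1]
    simp
  have h7 : c • (7 : 𝓞 K) = 7 := by
    simpa using map_ofNat (MulSemiringAction.toRingHom _ (𝓞 K) c) 7
  obtain ⟨η, hη⟩ := hdvd
  have hcs : c • s = s * c • η := by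
    have := congrArg (c • ·) hη
    simpa [hcc] using this
  have hηc : η * c • η = 1 := by
    apply mul_left_cancel₀ hs0
    linear_combination -hη - η * hcs
  set e := c • η with he
  set θ := -(e * ζ) with hθ
  have hθc : θ * c • θ = 1 := by
    rw [hθ, smul_neg, smul_mul', he, hcc]
    linear_combination hζc * (c • η * η) + hηc
  -- Conjugating `hs` gives `s * e * conj q = 1 - ζ⁻¹ = -ζ⁻¹ * s * q`.
  have hq : s ^ 2 + s + 7 = θ * ((s * e) ^ 2 + s * e + 7) := by
    have h1 := congrArg (c • ·) hs
    simp only [smul_mul', smul_add, smul_sub, smul_pow', smul_one, h7, hcs] at h1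
    apply mul_left_cancel₀ hs0
    rw [hs, hθ]
    linear_combination ζ * h1 - hζc
  have hkey : 7 * (1 - θ) = -(s * ((1 - θ * e ^ 2) * s + (1 - θ * e))) := by
    linear_combination hq
  have hy2 : ∀ φ : K →+* ℂ, ‖φ ((1 - ζ : 𝓞 K) : K)‖ ≤ 2 := fun φ ↦ by
    have := norm_sub_le 1 (φ (ζ : K))
    rw [norm_one, hnorm ζ hζc φ] at this
    push_cast
    rw [map_sub, map_one]
    linarith
  have hsφ : ∀ φ : K →+* ℂ, φ s * (φ s ^ 2 + φ s + 7) = φ ((1 - ζ : 𝓞 K) : K) := fun φ ↦ by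
    rw [← hs]; simp only [map_mul, map_add, map_pow, map_ofNat]
  have hφs0 : ∀ φ : K →+* ℂ, φ s ≠ 0 := fun φ ↦ by simpa using hs0
  by_cases hθ1 : θ = 1
  · have h1 : (1 - e) * ((1 + e) * s + 1) = 0 := by
      rw [hθ1] at hkey
      apply mul_left_cancel₀ hs0
      linear_combination hkey
    rcases mul_eq_zero.mp h1 with h2 | h2
    · -- `s` is real in every embedding
      refine not_forall_norm_embedding_lt_one hs0 fun φ ↦ ?_
      have hreal : conj (φ (s : K)) = φ s := by
        rw [← hconj, hcs, ← sub_eq_zero.mp h2, mul_one]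
      obtain ⟨x, hx⟩ := Complex.conj_eq_iff_real.mp hreal
      have h3 := hy2 φ
      rw [← hsφ, hx] at h3
      rw [hx]
      norm_cast at h3 ⊢
      rw [norm_mul, Real.norm_eq_abs (x ^ 2 + x + 7), abs_of_pos (by nlinarith)] at h3
      nlinarith [sq_nonneg (x + 1 / 2), norm_nonneg x]
    -- Here `e = -ζ⁻¹`, so `s = ζ/(1 - ζ)`, and the cubic becomes `t(t - 7) = 1`. Every conjugate of
    -- `t` is at most 0, hence lies in `(-1, 0)`.
    · have h3 : (1 - ζ) * s = ζ := by
        linear_combination (-ζ) * h2 - s * hθ - s * hθ1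
      set t := ζ + c • ζ - 2 with ht
      have h4 : (1 - ζ) ^ 2 = ζ * t := by rw [ht]; linear_combination -hζc
      have hζ0 : ζ ≠ 0 := left_ne_zero_of_mul_eq_one hζc
      have h5 : t * (t - 7) = 1 := by
        apply mul_left_cancel₀ (pow_ne_zero 2 hζ0)
        have h6 : ζ * (ζ ^ 2 + ζ * (1 - ζ) + 7 * (1 - ζ) ^ 2) = (1 - ζ) ^ 4 := by
          linear_combination (1 - ζ) ^ 3 * hs
            - (((1 - ζ) * s) ^ 2 + (1 - ζ) * s * ζ + ζ ^ 2) * h3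
            - (1 - ζ) * ((1 - ζ) * s + ζ) * h3 - 7 * (1 - ζ) ^ 2 * h3
        linear_combination -h6 + 7 * ζ * h4 - ((1 - ζ) ^ 2 + ζ * t) * h4
      refine not_forall_norm_embedding_lt_one (left_ne_zero_of_mul_eq_one h5) fun φ ↦ ?_
      have h6 : φ t = ((2 * (φ ζ).re - 2 : ℝ) : ℂ) := by
        simp only [ht, map_add, map_sub, map_ofNat]
        rw [hconj, Complex.add_conj]
        simp
      have h8 : (2 * (φ (ζ : K)).re - 2) ≤ 0 := by
        have := Complex.re_le_norm (φ (ζ : K))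
        rw [hnorm ζ hζc φ] at this
        linarith
      have h9 : φ t * (φ t - 7) = 1 := by
        have := congrArg (fun x : 𝓞 K ↦ φ (x : K)) h5
        simpa only [map_mul, map_sub, map_one, map_ofNat] using this
      rw [h6] at h9 ⊢
      norm_cast at h9 ⊢
      rw [Real.norm_eq_abs, abs_lt]
      constructor <;> nlinarith
  -- Away from 7, `s ∣ 7(1 - θ)` gives `s ∣ 1 - θ`; if `1 - ζ ∣ 7`, then `s ∣ 7` and so `s ∣ s² + s
  -- + 7`. The product covers both cases.
  · have hdiv : s ^ 2 ∣ (1 - θ) ^ 3 * (s ^ 2 + s + 7) ^ 2 := by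
      rcases hcop with ⟨N, ⟨u, v, huv⟩, N', hN⟩ | ⟨m, hm⟩
      · have h1 : s ∣ 1 - θ := by
          have huv' : (u : 𝓞 K) * N + v * 7 = 1 := by
            exact_mod_cast congrArg (Int.cast : ℤ → 𝓞 K) huv
          refine ⟨u * N' * (1 - θ) - v * ((1 - θ * e ^ 2) * s + (1 - θ * e)), ?_⟩
          linear_combination (-(1 - θ)) * huv' + u * (1 - θ) * hN + v * hkey
        exact ((pow_dvd_pow_of_dvd h1 2).trans (pow_dvd_pow _ (by lia))).mul_right _
      · refine (pow_dvd_pow_of_dvd (⟨(s + 1) * (1 + m * s) + (1 - ζ) * m ^ 2, ?_⟩ :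
          s ∣ s ^ 2 + s + 7) 2).mul_left _
        apply mul_left_cancel₀ hs0
        linear_combination (-(m * s)) * hs + s * (1 + m * s) * hm
    obtain ⟨t, ht⟩ := hdiv
    have hq0 : s ^ 2 + s + 7 ≠ 0 := right_ne_zero_of_mul (hs ▸ hζ1)
    have ht0 : t ≠ 0 := by
      rintro rfl
      rw [mul_zero] at ht
      exact mul_ne_zero (pow_ne_zero _ (sub_ne_zero.mpr (Ne.symm hθ1))) (pow_ne_zero _ hq0) ht
    refine not_forall_norm_embedding_lt_one ht0 fun φ ↦ ?_
    have hkeyφ := congrArg (fun x : 𝓞 K ↦ φ (x : K)) hkey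
    have htφ := congrArg (fun x : 𝓞 K ↦ φ (x : K)) ht
    simp only [map_mul, map_sub, map_add, map_neg, map_pow, map_one, map_ofNat] at hkeyφ htφ
    have hce : c • e = η := by rw [he, hcc]
    have hlt := norm_cube_mul_sq_lt (hsφ φ) (hy2 φ) (hφs0 φ) (hnorm θ hθc φ)
      (hnorm e (by rw [hce, mul_comm]; exact hηc) φ) hkeyφ
    rw [htφ, norm_mul] at hlt
    exact (mul_lt_iff_lt_one_right (norm_pos_iff.mpr (pow_ne_zero 2 (hφs0 φ)))).mp hlt

/-- For a root of unity `ζ ≠ 1`, the equation `s³ + s² + 7s = 1 - ζ` has no solution in an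
abelian number field. -/
theorem cubic_ne_one_sub_root_of_unity [IsAbelianGalois ℚ K] {k : ℕ} (hk : 2 ≤ k) {ζ s : 𝓞 K}
    (hζ : IsPrimitiveRoot ζ k) : s * (s ^ 2 + s + 7) ≠ 1 - ζ := by
  intro hs₀
  obtain ⟨c, hc⟩ := exists_gal_eq_conj (K := K)
  obtain ⟨s, hs, hfix⟩ := exists_root_fixed_by_cubes (G := Gal(K/ℚ)) (y := 1 - ζ) (s := s)
    (by linear_combination hs₀)
  have hs' : s * (s ^ 2 + s + 7) = 1 - ζ := by linear_combination hs
  have hsdvd : s ∣ 1 - ζ := ⟨_, hs'.symm⟩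
  have hs0 : s ≠ 0 := by
    rintro rfl
    simp only [zero_mul] at hs'
    exact hζ.ne_one (by lia) (sub_eq_zero.mp hs'.symm).symm
  have hcc : c * c = 1 := by
    let φ₀ : K →+* ℂ := Classical.choice (inferInstance : Nonempty _)
    ext x
    apply φ₀.injective
    simp [hc]
  refine absurd hs' ?_
  by_cases hpp : ∃ p : ℕ, p.Prime ∧ ∃ a : ℕ, p ^ a = k
  · obtain ⟨p, hp, a, rfl⟩ := hpp
    obtain ⟨a, rfl⟩ : ∃ b, a = b + 1 :=
      Nat.exists_eq_succ_of_ne_zero (by rintro rfl; simp at hk)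
    have hdvd : 1 - ζ ∣ (p : 𝓞 K) := by
      rw [← neg_sub, neg_dvd]; exact sub_one_dvd_natCast_prime hp hζ
    refine cubic_ne_of_conj_dvd hk hζ c hc ?_ ?_
    · refine conj_dvd_self_of_dvd_sub_one hp
        (hζ.map_of_injective (f := algebraMap (𝓞 K) K) RingOfIntegers.coe_injective) hs0
        (by rwa [← neg_sub, dvd_neg]) (fun g hg ↦ hfix g ?_) c hcc
      rw [smul_sub, smul_one]
      congr 1
      exact RingOfIntegers.coe_injective hg
    · rcases eq_or_ne p 7 with rfl | h7
      · exact Or.inr (by simpa using hdvd)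
      · refine Or.inl ⟨p, ?_, by simpa using hsdvd.trans hdvd⟩
        exact_mod_cast Nat.isCoprime_iff_coprime.mpr
          ((Nat.coprime_primes hp (by norm_num : Nat.Prime 7)).mpr h7)
  · push Not at hpp
    have h1 : 1 - ζ ∣ 1 := by
      have h := sub_dvd_eval_sub 1 ζ (cyclotomic k (𝓞 K))
      rwa [eval_one_cyclotomic_not_prime_pow (fun hp a ↦ hpp _ hp a),
        (hζ.isRoot_cyclotomic (by lia)).eq_zero, sub_zero] at h
    have hu : IsUnit s := isUnit_of_dvd_one (hsdvd.trans h1)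
    exact cubic_ne_of_conj_dvd hk hζ c hc (hu.map (MulSemiringAction.toRingHom _ (𝓞 K) c)).dvd
      (Or.inl ⟨1, isCoprime_one_left, by simpa using hu.dvd⟩)

end CubicEquation

/-! ### Reduction from `ratAb` to number fields -/

section AbelianCompositum

/-- A commutator restricts trivially to each `t i`, so its fixed field is the whole compositum. -/
theorem isAbelianGalois_iSup {F L ι : Type*} [Field F] [CharZero F] [Field L] [Algebra F L]
    (t : ι → IntermediateField F L) [h : ∀ i, IsAbelianGalois F (t i)] :
    IsAbelianGalois F (⨆ i, t i : IntermediateField F L) := by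
  have hn : Normal F (⨆ i, t i : IntermediateField F L) := IntermediateField.normal_iSup F L t
  obtain ⟨E, hE⟩ : ∃ E, E = ⨆ i, t i := ⟨_, rfl⟩
  rw [← hE] at hn ⊢
  have halg := hn.isAlgebraic
  have hgal : IsGalois F E := ⟨⟩
  refine { hgal with is_comm := ⟨fun σ τ ↦ ?_⟩ }
  set W : IntermediateField F E :=
    IntermediateField.fixedField (Subgroup.zpowers (σ * τ * σ⁻¹ * τ⁻¹)) with hW
  have hle : E ≤ IntermediateField.lift W := by
    refine hE.trans_le <| iSup_le fun i x hx ↦ ?_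
    have hi : t i ≤ E := (le_iSup t i).trans_eq hE.symm
    let T : IntermediateField F E := IntermediateField.restrict hi
    have hT : IsAbelianGalois F T :=
      IsAbelianGalois.of_algHom (IntermediateField.restrictAlgEquiv hi).symm.toAlgHom
    have hxT : (⟨x, hi hx⟩ : E) ∈ T := (IntermediateField.mem_restrict hi _).mpr hx
    have hcomm (f g : Gal(T/F)) : f * g = g * f := (IsMulCommutative.is_comm (M := Gal(T/F))).comm f g
    have hker : AlgEquiv.restrictNormalHom T (σ * τ * σ⁻¹ * τ⁻¹) = 1 := by
      rw [map_mul, map_mul, map_mul, map_inv, map_inv, hcomm (AlgEquiv.restrictNormalHom T σ)]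
      group
    have hfix : (σ * τ * σ⁻¹ * τ⁻¹) ⟨x, hi hx⟩ = ⟨x, hi hx⟩ := by
      have := AlgEquiv.restrictNormal_commutes (σ * τ * σ⁻¹ * τ⁻¹) T ⟨_, hxT⟩
      rw [show (σ * τ * σ⁻¹ * τ⁻¹).restrictNormal T = 1 from hker] at this
      exact this.symm
    refine (IntermediateField.mem_lift (⟨x, hi hx⟩ : E)).mpr ?_
    rw [hW, IntermediateField.mem_fixedField_iff]
    rintro _ ⟨n, rfl⟩
    exact (MulAction.mem_fixedBy_zpowers_iff_mem_fixedBy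
      (g := (σ * τ * σ⁻¹ * τ⁻¹)) (a := (⟨x, hi hx⟩ : E))).mpr hfix n
  have h1 : σ * τ * σ⁻¹ * τ⁻¹ = 1 := by
    ext x
    have hx : x ∈ W := (IntermediateField.mem_lift x).mp (hle x.2)
    rw [hW, IntermediateField.mem_fixedField_iff] at hx
    rw [hx _ (Subgroup.mem_zpowers _), AlgEquiv.one_apply]
  rw [mul_inv_eq_one, mul_inv_eq_iff_eq_mul] at h1
  exact h1

theorem isAbelianGalois_of_le_ratAb {E : IntermediateField ℚ ℂ} (h : E ≤ ratAb) :
    IsAbelianGalois ℚ E := by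
  have : IsAbelianGalois ℚ ratAb :=
    isAbelianGalois_iSup (fun K : {K : IntermediateField ℚ ℂ // IsAbelianGalois ℚ K} ↦ K.1)
      (h := fun K ↦ K.2)
  exact @IsAbelianGalois.of_algHom ℚ E ratAb _ _ _ _ _ (IntermediateField.inclusion h) this

theorem mem_ratAb_of_isPrimitiveRoot {k : ℕ} (hk : k ≠ 0) {ζ : ℂ} (hζ : IsPrimitiveRoot ζ k) :
    ζ ∈ ratAb := by
  have : NeZero k := ⟨hk⟩
  have hint : IsIntegral ℚ ζ := (hζ.isIntegral (Nat.pos_of_ne_zero hk)).tower_top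
  let F := IntermediateField.adjoin ℚ {ζ}
  have hF : IsCyclotomicExtension {k} ℚ F := by
    have h1 := hζ.adjoin_isCyclotomicExtension ℚ
    exact IsCyclotomicExtension.equiv {k} ℚ _ (Subalgebra.equivOfEq _ F.toSubalgebra
      (IntermediateField.adjoin_simple_toSubalgebra_of_isAlgebraic hint.isAlgebraic).symm)
  have hab : IsAbelianGalois ℚ F := IsCyclotomicExtension.isAbelianGalois {k} ℚ F
  exact le_iSup (fun K : {K : IntermediateField ℚ ℂ // IsAbelianGalois ℚ K} ↦ K.1) ⟨F, hab⟩
    (IntermediateField.mem_adjoin_simple_self ℚ ζ)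

theorem cubic_ne_of_mem_ratAb {k : ℕ} (hk : 2 ≤ k) {ζ s : ℂ} (hζ : IsPrimitiveRoot ζ k)
    (hs : s ∈ ratAb) : s * (s ^ 2 + s + 7) ≠ 1 - ζ := by
  intro h
  have hζint : IsIntegral ℤ ζ := hζ.isIntegral (by lia)
  have hsint : IsIntegral ℤ s := by
    let A := integralClosure ℤ ℂ
    let z : A := ⟨ζ, hζint⟩
    have h1 : IsIntegral A s := by
      refine ⟨X ^ 3 + X ^ 2 + 7 * X - C (1 - z), by monicity!, ?_⟩
      have h2 : algebraMap A ℂ z = ζ := rfl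
      simp only [eval₂_sub, eval₂_add, eval₂_mul, eval₂_pow, eval₂_X, eval₂_C, eval₂_one, eval₂_ofNat,
        map_sub, map_one, h2]
      linear_combination h
    exact isIntegral_trans s h1
  let E := IntermediateField.adjoin ℚ {s, ζ}
  have hE : E ≤ ratAb := by
    rw [IntermediateField.adjoin_le_iff]
    rintro x (rfl | rfl)
    · exact hs
    · exact mem_ratAb_of_isPrimitiveRoot (by lia) hζ
  have := isAbelianGalois_of_le_ratAb hE
  have : FiniteDimensional ℚ E := by
    refine IntermediateField.finiteDimensional_adjoin ?_
    rintro x (rfl | rfl)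
    · exact hsint.tower_top
    · exact hζint.tower_top
  have : NumberField E := ⟨⟩
  let s₀ : E := ⟨s, IntermediateField.subset_adjoin _ _ (by simp)⟩
  let z₀ : E := ⟨ζ, IntermediateField.subset_adjoin _ _ (by simp)⟩
  have hs' : IsIntegral ℤ s₀ :=
    (isIntegral_algHom_iff (E.val.restrictScalars ℤ) E.val.injective).mp hsint
  have hz' : IsIntegral ℤ z₀ :=
    (isIntegral_algHom_iff (E.val.restrictScalars ℤ) E.val.injective).mp hζint
  let ψ : 𝓞 E →+* ℂ := (algebraMap E ℂ).comp (algebraMap (𝓞 E) E)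
  have hinj : Function.Injective ψ :=
    (algebraMap E ℂ).injective.comp RingOfIntegers.coe_injective
  obtain ⟨σ, hσ⟩ : ∃ σ : 𝓞 E, ψ σ = s := ⟨⟨s₀, hs'⟩, rfl⟩
  obtain ⟨ξ, hξ⟩ : ∃ ξ : 𝓞 E, ψ ξ = ζ := ⟨⟨z₀, hz'⟩, rfl⟩
  have hz : IsPrimitiveRoot ξ k := IsPrimitiveRoot.of_map_of_injective (f := ψ) (by rwa [hξ]) hinj
  refine cubic_ne_one_sub_root_of_unity hk (s := σ) hz (hinj ?_)
  rw [map_mul, map_add, map_add, map_pow, map_sub, map_one, map_ofNat, hσ, hξ]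
  exact h

end AbelianCompositum

/-! ### The multiplier polynomial of period 3 -/

section Multiplier

theorem quadIter_one : quadIter 1 = X ^ 2 + C X := by simp [quadIter]

theorem quadIter_three : quadIter 3 = ((X ^ 2 + C X) ^ 2 + C X) ^ 2 + C X := by simp [quadIter]

theorem dynatomicPoly_three : dynatomicPoly 3 =
    X ^ 6 + X ^ 5 + C (3 * X + 1) * X ^ 4 + C (2 * X + 1) * X ^ 3 +
      C (3 * X ^ 2 + 3 * X + 1) * X ^ 2 + C (X ^ 2 + 2 * X + 1) * X +
      C (X ^ 3 + 2 * X ^ 2 + X + 1) := by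
  have h1 : (3 : ℕ).divisors.filter (fun k ↦ ArithmeticFunction.moebius (3 / k) = 1) = {3} := by
    have : ArithmeticFunction.moebius 3 = -1 :=
      ArithmeticFunction.moebius_apply_prime Nat.prime_three
    rw [Nat.prime_three.divisors]
    simp [Finset.filter_insert, Finset.filter_singleton, this]
  have h2 : (3 : ℕ).divisors.filter (fun k ↦ ArithmeticFunction.moebius (3 / k) = -1) = {1} := by
    have : ArithmeticFunction.moebius 3 = -1 :=
      ArithmeticFunction.moebius_apply_prime Nat.prime_three
    rw [Nat.prime_three.divisors]
    simp [Finset.filter_insert, Finset.filter_singleton, this]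
  have hm : (quadIter 1 - X).Monic := by rw [quadIter_one]; monicity!
  rw [dynatomicPoly, h1, h2, Finset.prod_singleton, Finset.prod_singleton]
  rw [← mul_divByMonic_cancel_left (X ^ 6 + X ^ 5 + C (3 * X + 1) * X ^ 4 + C (2 * X + 1) * X ^ 3 +
      C (3 * X ^ 2 + 3 * X + 1) * X ^ 2 + C (X ^ 2 + 2 * X + 1) * X +
      C (X ^ 3 + 2 * X ^ 2 + X + 1)) hm]
  congr 1
  rw [quadIter_one, quadIter_three]
  simp only [map_add, map_mul, map_pow, map_one, map_ofNat]
  ring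

variable {S : Type*} [CommRing S]

/-- The monic cubic whose roots form a `3`-cycle of `z² + c` with sum `t`, where
`c = -(t² + t + 2)`. -/
noncomputable def cyclePoly (t : S) : S[X] :=
  X ^ 3 - C t * X ^ 2 - C (t ^ 2 + 2 * t + 3) * X + C (t ^ 3 + 2 * t ^ 2 + 3 * t + 1)

/-- The multiplier of the `3`-cycle given by `cyclePoly t`. -/
def cycleMultiplier (t : S) : S := -8 * (t ^ 3 + 2 * t ^ 2 + 3 * t + 1)

theorem natDegree_cyclePoly [Nontrivial S] (t : S) : (cyclePoly t).natDegree = 3 := by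
  unfold cyclePoly; compute_degree!

theorem coeff_cyclePoly [Nontrivial S] (t : S) : (cyclePoly t).coeff 3 = 1 := by
  have h : (cyclePoly t).Monic := by unfold cyclePoly; monicity!
  rw [← natDegree_cyclePoly t, coeff_natDegree, h]

/-- `x - (f_c^{∘3})'(z)` with `c = -(t² + t + 2)`. -/
noncomputable def multiplierShift (x t : S) : S[X] :=
  C x - 8 * X * (X ^ 2 + C (-(t ^ 2 + t + 2))) *
    ((X ^ 2 + C (-(t ^ 2 + t + 2))) ^ 2 + C (-(t ^ 2 + t + 2)))

/-- Modulo `cyclePoly t` the derivative of the third iterate is constant, equal to the multiplier,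
and the resultant depends only on this residue. -/
theorem resultant_cyclePoly [Nontrivial S] (x t : S) :
    resultant (cyclePoly t) (multiplierShift x t) 3 7 = (x - cycleMultiplier t) ^ 3 := by
  have h : multiplierShift x t = C (x - cycleMultiplier t) + cyclePoly t *
      -(8 * X ^ 4 + C (8 * t) * X ^ 3 - C (8 * t ^ 2 + 8 * t + 24) * X ^ 2 -
        C (8 * t ^ 3 + 8 * t ^ 2 + 24 * t + 8) * X + 8) := by
    simp only [multiplierShift, cyclePoly, cycleMultiplier, map_add, map_mul, map_pow, map_one,
      map_ofNat, map_sub, map_neg]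
    ring
  rw [h, resultant_add_mul_right _ _ _ _ _ ?_ (natDegree_cyclePoly t).le, resultant_C_right,
    coeff_cyclePoly, one_pow, one_mul]
  have : (-(8 * X ^ 4 + C (8 * t) * X ^ 3 - C (8 * t ^ 2 + 8 * t + 24) * X ^ 2 -
        C (8 * t ^ 3 + 8 * t ^ 2 + 24 * t + 8) * X + 8 : S[X])).natDegree ≤ 4 := by
    compute_degree
  lia

/-- The substitution `c = -(t² + t + 2)`. -/
noncomputable def cycleSubst : ℤ[X] →+* ℤ[X] :=
  (aeval (-(X ^ 2 + X + 2) : ℤ[X])).toRingHom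

theorem cycleSubst_X : cycleSubst X = -(X ^ 2 + X + 2) := by simp [cycleSubst]

theorem cycleSubst_injective : Function.Injective cycleSubst := by
  rw [injective_iff_map_eq_zero]
  intro p hp
  have hp' : p.comp (-(X ^ 2 + X + 2)) = 0 := by
    rw [← hp]; rfl
  have hdeg : (-(X ^ 2 + X + 2) : ℤ[X]).natDegree = 2 := by
    rw [natDegree_neg]; compute_degree!
  rcases comp_eq_zero_iff.mp hp' with h | ⟨-, h⟩
  · exact h
  · rw [h, natDegree_C] at hdeg
    lia

/-- After the injective substitution `c = -(t² + t + 2)`, the dynatomic polynomial splits into the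
two 3-cycles, with sums `t` and `-1 - t`, and the resultant can be computed on each. -/
theorem multiplierResultant_three : multiplierResultant 3 =
    (X ^ 2 - C (8 * X + 16) * X + C (64 * (X ^ 3 + 2 * X ^ 2 + X + 1))) ^ 3 := by
  have hinj : Function.Injective (mapRingHom cycleSubst) :=
    map_injective _ cycleSubst_injective
  apply hinj
  have hd : derivative (quadIter 3) =
      8 * X * (X ^ 2 + C X) * ((X ^ 2 + C X) ^ 2 + C X) := by
    rw [quadIter_three]
    simp only [derivative_add, derivative_pow, derivative_C, derivative_X, Nat.cast_ofNat,
      map_ofNat]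
    ring
  have hf : ((dynatomicPoly 3).map (C : ℤ[X] →+* ℤ[X][X])).natDegree = 6 := by
    rw [natDegree_map_eq_of_injective C_injective, dynatomicPoly_three]
    compute_degree!
  have hg : (C X - (derivative (quadIter 3)).map (C : ℤ[X] →+* ℤ[X][X])).natDegree = 7 := by
    rw [hd]
    simp only [Polynomial.map_mul, Polynomial.map_add, Polynomial.map_pow, Polynomial.map_X,
      Polynomial.map_C, Polynomial.map_ofNat]
    compute_degree!
  -- The default degrees of the resultant are fixed at 6 and 7 before mapping coefficients.
  rw [multiplierResultant, hf, hg, ← resultant_map_map]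
  have h1 : ((dynatomicPoly 3).map (C : ℤ[X] →+* ℤ[X][X])).map (mapRingHom cycleSubst) =
      cyclePoly (C X : ℤ[X][X]) * cyclePoly (-1 - C X : ℤ[X][X]) := by
    rw [dynatomicPoly_three]
    simp only [Polynomial.map_mul, Polynomial.map_add, Polynomial.map_pow, Polynomial.map_X,
      Polynomial.map_C, Polynomial.map_ofNat, map_add, map_mul, map_pow, map_one, map_ofNat,
      coe_mapRingHom, cycleSubst_X, cyclePoly, map_neg, map_sub, 
      Polynomial.map_one]
    ring
  have h2 : (C X - (derivative (quadIter 3)).map (C : ℤ[X] →+* ℤ[X][X])).map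
      (mapRingHom cycleSubst) = multiplierShift X (C X : ℤ[X][X]) := by
    rw [hd, multiplierShift]
    simp only [Polynomial.map_mul, Polynomial.map_add, Polynomial.map_pow, Polynomial.map_X,
      Polynomial.map_C, Polynomial.map_ofNat, map_add, map_pow, map_ofNat,
      coe_mapRingHom, cycleSubst_X, map_neg, Polynomial.map_sub]
  have h3 : multiplierShift (X : ℤ[X][X]) (C X) = multiplierShift X (-1 - C X : ℤ[X][X]) := by
    simp only [multiplierShift, map_add, map_pow, map_one, map_ofNat, map_neg, map_sub]
    ring
  have h4 : (multiplierShift (X : ℤ[X][X]) (C X)).natDegree ≤ 7 := by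
    rw [multiplierShift]; compute_degree
  have h5 := resultant_mul_left (cyclePoly (C X : ℤ[X][X])) (cyclePoly (-1 - C X))
    (multiplierShift X (C X)) 7 h4
  rw [natDegree_cyclePoly, natDegree_cyclePoly] at h5
  rw [h1, h2, h5, resultant_cyclePoly, h3, resultant_cyclePoly, ← mul_pow]
  simp only [cycleMultiplier, coe_mapRingHom, Polynomial.map_mul, Polynomial.map_add,
    Polynomial.map_pow, Polynomial.map_X, Polynomial.map_C, map_add, map_mul, map_pow, map_one,
    map_ofNat, cycleSubst_X, Polynomial.map_sub, map_neg, Polynomial.map_ofNat]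
  ring

theorem isMultiplierPoly_multiplierPoly_three : IsMultiplierPoly 3 (multiplierPoly 3) := by
  have h : ∃ d, IsMultiplierPoly 3 d :=
    ⟨_, by monicity!, multiplierResultant_three.symm⟩
  rw [multiplierPoly, dif_pos h]
  exact h.choose_spec

theorem exists_primitiveRoot_of_deltaFactorTilde_eq_zero {k : ℕ} (hk : k ≠ 0) {x : ℂ}
    (hx : aeval x (deltaFactorTilde (3 * k) 3) = 0) :
    ∃ ζ : ℂ, IsPrimitiveRoot ζ k ∧
      ζ ^ 2 - (2 * x + 16) * ζ + (x ^ 3 + 8 * x ^ 2 + 16 * x + 64) = 0 := by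
  obtain ⟨hmonic, hpow⟩ := isMultiplierPoly_multiplierPoly_three
  set φ : ℤ[X] →+* ℂ := (aeval (x / 4)).toRingHom with hφ
  have hφX : φ X = x / 4 := by simp [hφ]
  have h1 : φ (deltaFactor (3 * k) 3) = 0 := by
    rw [← hx, deltaFactorTilde, aeval_comp, ← algebraMap_int_eq, aeval_map_algebraMap]
    change aeval (x / 4) _ = _
    congr 2
    simp only [map_mul, aeval_C, aeval_X]
    simp
    ring
  rw [deltaFactor, Nat.mul_div_cancel_left _ three_pos, ← resultant_map_map,
    ← (cyclotomic.monic k ℤ[X]).natDegree_map φ, ← hmonic.natDegree_map φ, map_cyclotomic,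
    resultant_eq_zero_iff, isCoprime_iff_aeval_ne_zero_of_isAlgClosed ℂ ℂ] at h1
  obtain ⟨-, h1⟩ := h1
  push Not at h1
  obtain ⟨ζ, h2, h3⟩ := h1
  have : NeZero (k : ℂ) := ⟨by exact_mod_cast hk⟩
  refine ⟨ζ, isRoot_cyclotomic_iff.mp (by simpa using h2), ?_⟩
  -- Only the cube of `multiplierPoly 3` is known explicitly, which is enough to test vanishing at
  -- `ζ`.
  have h4 := congrArg (fun p ↦ eval ζ (p.map φ)) (hpow.trans multiplierResultant_three)
  have h5 : eval ζ ((multiplierPoly 3).map φ) = 0 := by simpa using h3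
  simp only [Polynomial.map_pow, eval_pow, h5, Polynomial.map_add, Polynomial.map_sub,
    Polynomial.map_mul, Polynomial.map_X, Polynomial.map_C, eval_add, eval_sub, eval_mul, eval_X,
    eval_C, Polynomial.map_ofNat, Polynomial.map_one, eval_ofNat, eval_one, map_add, map_mul, map_pow,
    map_one, map_ofNat, hφX] at h4
  have h6 := pow_eq_zero_iff (three_ne_zero) |>.mp (h4.symm.trans (zero_pow three_ne_zero))
  linear_combination h6

end Multiplier

theorem theorem4p3 (k : ℕ) (hk : 2 ≤ k) (x : ℂ) (hx : x ∈ ratAb) :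
    Polynomial.aeval x (deltaFactorTilde (3 * k) 3) ≠ 0 := by
  intro h
  obtain ⟨ζ, hζ, hx3⟩ := exists_primitiveRoot_of_deltaFactorTilde_eq_zero (by lia) h
  have hζab := mem_ratAb_of_isPrimitiveRoot (by lia) hζ
  have hx0 : x ≠ 0 := by
    rintro rfl
    have h8 : ζ = 8 := by
      rw [← sub_eq_zero, ← pow_eq_zero_iff (two_ne_zero)]
      linear_combination hx3
    have h1 := hζ.norm'_eq_one (by lia)
    rw [h8] at h1
    norm_num at h1
  have hab (n : ℕ) : (n : ℂ) ∈ ratAb := natCast_mem _ n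
  refine cubic_ne_of_mem_ratAb hk hζ (s := (ζ - 8 - x) / x)
    (div_mem (sub_mem (sub_mem hζab (hab 8)) hx) hx) ?_
  have hs : ((ζ - 8 - x) / x) * x = ζ - 8 - x := div_mul_cancel₀ _ hx0
  generalize (ζ - 8 - x) / x = s at hs
  -- Thus `x = -(s² + 7)`, and `ζ = 8 + x + s * x` becomes the cubic in `s`.
  have hs2 : s ^ 2 = -(x + 7) := by
    apply mul_left_cancel₀ (pow_ne_zero 2 hx0)
    linear_combination (s * x + (ζ - 8 - x)) * hs + hx3
  linear_combination (s + 1) * hs2 - hs
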